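/- A gate on $N$ lines is $TOF(I;t)$ with $I\subseteq\{1,\dots,N\}$, $|I|\le 2$, $t\in\{1,\dots,N\}\setminus I$; it acts on $\{0,1\}^N$ by replacing $x_t$ by $x_t\oplus\bigwedge_{i\in I}x_i$ (NOT, CNOT and Toffoli gates for $|I|=0,1,2$) and keeping the other coordinates. A reversible circuit $\mathfrak S$ with $N$ inputs is a finite composition of such gates; given weights $W^{(C)},W^{(T)}\ge 0$, its quantum weight $W(\mathfrak S)$ is $W^{(C)}$ times its number of NOT and CNOT gates plus $W^{(T)}$ times its number of Toffoli gates. A circuit with $n+q$ inputs implements $f:\{0,1\}^n\to\{0,1\}^n$ with $q$ additional inputs if, after some fixed permutation of its outputs, it sends $\langle x_1,\dots,x_n,0,\dots,0\rangle$ to $\langle f(x)_1,\dots,f(x)_n,*,\dots,*\rangle$ for every $x\in\{0,1\}^n$ (the outputs $*$ are arbitrary). Let $F(n,q)$ be the set of all $f$ implemented by some circuit with $n+q$ inputs, let $W(f,q)$ be the minimum of $W(\mathfrak S)$ over the circuits $\mathfrak S$ implementing $f$ with $q$ additional inputs, and let $W(n,q)=\max_{f\in F(n,q)}W(f,q)$.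 Theorem. Let $\varphi,\psi:\mathbb N\to\mathbb R$ satisfy $\varphi(n)\to\infty$, $\psi(n)\to\infty$ and $\varphi(n)\le n/(\log_2 n+\log_2\psi(n))$ for all sufficiently large $n$, and let $q_0:\mathbb N\to\mathbb N$ satisfy $q_0(n)\sim n\,2^{n-\lceil n/\varphi(n)\rceil}$ as $n\to\infty$. Then $$W(n,q_0(n))\lesssim W^{(C)}\cdot 2^n+W^{(T)}\cdot n\,2^{n-\lceil n/\varphi(n)\rceil},$$ uniformly in the weights; that is, there is a sequence $\varepsilon(n)\to 0$, not depending on the weights, such that for all sufficiently large $n$ and all $W^{(C)},W^{(T)}\ge 0$ $$W(n,q_0(n))\le(1+\varepsilon(n))\left(W^{(C)}\cdot 2^n+W^{(T)}\cdot n\,2^{n-\lceil n/\varphi(n)\rceil}\right).$$ -/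

import Mathlib

open Filter Topology Asymptotics

namespace ReversibleCircuit

/-- The set `𝔹^n` of Boolean vectors. -/
abbrev BVec (n : ℕ) : Type := Fin n → Bool

/-- A gate `TOF(I; t)` on `N` lines with `|I| < 3`, i.e. an element of `Ω_N^2`: a NOT gate
(`|I| = 0`), a CNOT gate (`|I| = 1`) or a C²NOT (Toffoli) gate (`|I| = 2`). -/
structure Gate (N : ℕ) where
  controls : Finset (Fin N)
  target : Fin N
  target_notMem : target ∉ controls
  card_controls_lt : controls.card < 3

/-- The transformation defined by a gate: `x_t` is replaced by `x_t ⊕ ⋀_{i ∈ I} x_i`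
(the empty conjunction is `1`), all other coordinates are kept. -/
def Gate.apply {N : ℕ} (g : Gate N) (x : BVec N) : BVec N :=
  Function.update x g.target (xor (x g.target) (decide (∀ i ∈ g.controls, x i = true)))

/-- The weight of a gate: `wC` for NOT and CNOT, `wT` for C²NOT. -/
def Gate.weight {N : ℕ} (wC wT : ℝ) (g : Gate N) : ℝ :=
  if g.controls.card < 2 then wC else wT

/-- A reversible circuit with `N` inputs: a finite composition (chain) of gates. -/
abbrev Circuit (N : ℕ) : Type := List (Gate N)

/-- The output of a circuit, its gates being applied from the first to the last. -/
def Circuit.run {N : ℕ} (S : Circuit N) (x : BVec N) : BVec N :=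
  S.foldl (fun y g => g.apply y) x

/-- The quantum weight `W(𝔖)`: the sum of the weights of the gates of the circuit. -/
def Circuit.weight {N : ℕ} (wC wT : ℝ) (S : Circuit N) : ℝ :=
  (S.map (Gate.weight wC wT)).sum

/-- The circuit `S` with `n + q` inputs implements `f : 𝔹^n → 𝔹^n` with `q` additional inputs:
for some permutation of the outputs, every input `⟨x_1, …, x_n, 0, …, 0⟩` is transformed into
`⟨f(x)_1, …, f(x)_n, *, …, *⟩`. -/
def Circuit.Implements {n q : ℕ} (S : Circuit (n + q)) (f : BVec n → BVec n) : Prop :=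
  ∃ π : Equiv.Perm (Fin (n + q)), ∀ (x : BVec n) (i : Fin n),
    S.run (Fin.append x (fun _ : Fin q => false)) (π (Fin.castAdd q i)) = f x i

/-- `F(n, q)`: the transformations `𝔹^n → 𝔹^n` implemented by circuits with `n + q` inputs. -/
def implementable (n q : ℕ) : Set (BVec n → BVec n) :=
  {f | ∃ S : Circuit (n + q), S.Implements f}

/-- The weights of the circuits that implement `f` with `q` additional inputs. -/
def weightSet (wC wT : ℝ) {n : ℕ} (f : BVec n → BVec n) (q : ℕ) : Set ℝ :=
  {w | ∃ S : Circuit (n + q), S.Implements f ∧ S.weight wC wT = w}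

/-- `W(f, q)`: the minimum quantum weight of a circuit implementing `f` with `q` additional
inputs (a true minimum for `f ∈ F(n, q)`, see `isLeast_minWeight`). -/
noncomputable def minWeight (wC wT : ℝ) {n : ℕ} (f : BVec n → BVec n) (q : ℕ) : ℝ :=
  sInf (weightSet wC wT f q)

/-- `W(n, q)`: the maximum of `W(f, q)` over `f ∈ F(n, q)`, the quantum weight function
(a true maximum, see `isGreatest_quantumWeight`). -/
noncomputable def quantumWeight (wC wT : ℝ) (n q : ℕ) : ℝ :=
  sSup ((fun f : BVec n → BVec n => minWeight wC wT f q) '' implementable n q)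

theorem exists_weight_eq (wC wT : ℝ) {N : ℕ} (S : Circuit N) :
    ∃ a b : ℕ, S.weight wC wT = wC * a + wT * b := by
  induction S with
  | nil => exact ⟨0, 0, by simp [Circuit.weight]⟩
  | cons g S ih =>
    obtain ⟨a, b, h⟩ := ih
    have hc : Circuit.weight wC wT (g :: S) = g.weight wC wT + Circuit.weight wC wT S := by
      simp [Circuit.weight]
    by_cases hg : g.controls.card < 2
    · exact ⟨a + 1, b, by rw [hc, h, Gate.weight, if_pos hg]; push_cast; ring⟩
    · exact ⟨a, b + 1, by rw [hc, h, Gate.weight, if_neg hg]; push_cast; ring⟩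

theorem isLeast_minWeight {wC wT : ℝ} (hC : 0 ≤ wC) (hT : 0 ≤ wT) {n q : ℕ}
    {f : BVec n → BVec n} (hf : f ∈ implementable n q) :
    IsLeast (weightSet wC wT f q) (minWeight wC wT f q) := by
  have hmono : Monotone (fun p : ℕ × ℕ => wC * (p.1 : ℝ) + wT * (p.2 : ℝ)) := by
    intro p r hpr
    have h1 : (p.1 : ℝ) ≤ r.1 := by exact_mod_cast hpr.1
    have h2 : (p.2 : ℝ) ≤ r.2 := by exact_mod_cast hpr.2
    have := mul_le_mul_of_nonneg_left h1 hC
    have := mul_le_mul_of_nonneg_left h2 hT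
    simp only
    linarith
  have hpwo : (Set.univ : Set (ℕ × ℕ)).IsPWO := Set.isPWO_of_wellQuasiOrderedLE _
  have hwf : (weightSet wC wT f q).IsWF := by
    refine ((hpwo.image_of_monotone hmono).isWF).mono ?_
    rintro w ⟨S, -, rfl⟩
    obtain ⟨a, b, h⟩ := exists_weight_eq wC wT S
    exact ⟨(a, b), trivial, h.symm⟩
  obtain ⟨S, hS⟩ := hf
  have hne : (weightSet wC wT f q).Nonempty := ⟨_, S, hS, rfl⟩
  have hl : IsLeast (weightSet wC wT f q) (hwf.min hne) :=
    ⟨hwf.min_mem hne, fun w hw => hwf.min_le hne hw⟩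
  rw [minWeight, hl.csInf_eq]
  exact hl

theorem isGreatest_quantumWeight (wC wT : ℝ) (n q : ℕ) :
    IsGreatest ((fun f : BVec n → BVec n => minWeight wC wT f q) '' implementable n q)
      (quantumWeight wC wT n q) := by
  have hfin : ((fun f : BVec n → BVec n => minWeight wC wT f q) '' implementable n q).Finite :=
    (Set.toFinite _).image _
  have hid : id ∈ implementable n q :=
    ⟨[], Equiv.refl _, fun x i => by simp [Circuit.run]⟩
  have hne : ((fun f : BVec n → BVec n => minWeight wC wT f q) '' implementable n q).Nonempty :=
    ⟨_, id, hid, rfl⟩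
  exact ⟨hne.csSup_mem hfin, fun w hw => le_csSup hfin.bddAbove hw⟩

end ReversibleCircuit

/-!
Boolean functions are added and multiplied in the two-element field: on `Bool`, `+` is `xor` and
`*` is `and`. With `k = ⌈n / φ n⌉` and `m = n - k`, split the `n` variables into `y` (`k` of them)
and `z` (`m` of them). By the algebraic normal form (`exists_algebraicNormalForm`), each output is
`f_i = ∑_R z^R h_{i,R}(y)` over the `2 ^ m` monomials `z^R`, and every `h_{i,R}` is a linear
combination of the `2 ^ k` monomials `y^T`. Distribute the `y^T` into `p = 2 ^ k / s + 1` groups of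
`s = n - 2 * k` and precompute on separate lines all monomials `y^T` and `z^R` and all subset sums
of all groups (`reach_data`). These are at most `4 * 2 ^ m` lines, each of which costs boundedly
many gates.

Each of the `n * 2 ^ m` terms `z^R h_{i,R}` is then added to the `i`-th output by one Toffoli gate
from the line `z^R` and an accumulator holding `h_{i,R}` (`exists_reach_add_products`). The
accumulator is never cleared. The difference of two consecutive `h` is again a linear combination
of the `y^T`, hence a sum of one precomputed subset sum per group, so passing from one term to the
next takes `p` CNOT gates.

The total is `n * 2 ^ m + O(2 ^ m)` Toffoli gates and `n * 2 ^ m * p + O(2 ^ m)` other gates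
(`exists_circuit`). As `φ n → ∞`, `k = o(n)` and `s` is asymptotic to `n`; the bound on `φ` gives
`2 ^ k ≥ n * ψ n`, so `n * 2 ^ m = o(2 ^ n)`. Hence `n * 2 ^ m * p` is asymptotically at most
`2 ^ n`. The circuit needs only `O(2 ^ m)` additional inputs, fewer than the roughly `n * 2 ^ m`
available.
-/

namespace ReversibleCircuit

/-! ### Evolution of labelled lines -/

/-- The lines labelled by `L` can be brought from the contents `v` to the contents `w` by a circuit
with at most `c` NOT and CNOT gates and at most `t` Toffoli gates. The contents of a line is a
Boolean function of a parameter `x : X` (the input of the whole computation), and the labelled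
lines may sit inside any larger circuit. -/
def Reach {L X : Type*} (v : L → X → Bool) (c t : ℕ) (w : L → X → Bool) : Prop :=
  ∀ (N : ℕ) (e : L ↪ Fin N), ∃ S : Circuit N,
    (∀ wC wT : ℝ, 0 ≤ wC → 0 ≤ wT → S.weight wC wT ≤ wC * c + wT * t) ∧
    ∀ (x : X) (V : BVec N), (∀ l, V (e l) = v l x) → ∀ l, S.run V (e l) = w l x

namespace Reach

variable {L X : Type*} {u v w : L → X → Bool} {c c' t t' : ℕ}

theorem refl (v : L → X → Bool) : Reach v 0 0 v := fun _ _ =>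
  ⟨[], fun _ _ _ _ => by simp [Circuit.weight], fun _ _ h => by simpa [Circuit.run] using h⟩

theorem trans (h : Reach u c t v) (h' : Reach v c' t' w) : Reach u (c + c') (t + t') w := by
  intro N e
  obtain ⟨S, hS, hr⟩ := h N e
  obtain ⟨S', hS', hr'⟩ := h' N e
  refine ⟨S ++ S', fun wC wT hC hT => ?_, fun x V hV l => ?_⟩
  · have e1 := hS wC wT hC hT
    have e2 := hS' wC wT hC hT
    have e3 : Circuit.weight wC wT (S ++ S') = S.weight wC wT + S'.weight wC wT := by
      simp [Circuit.weight]
    push_cast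
    linarith
  · have := hr' x (S.run V) (hr x V hV) l
    simpa [Circuit.run] using this

theorem mono (h : Reach v c t w) (hc : c ≤ c') (ht : t ≤ t') : Reach v c' t' w := by
  intro N e
  obtain ⟨S, hS, hr⟩ := h N e
  refine ⟨S, fun wC wT hC hT => (hS wC wT hC hT).trans ?_, hr⟩
  gcongr

/-- One gate adds to the target line the product of the control lines. -/
theorem gate [DecidableEq L] (v : L → X → Bool) (I : Finset L) (l : L) (hl : l ∉ I)
    (hI : I.card < 3) :
    Reach v (if I.card < 2 then 1 else 0) (if I.card < 2 then 0 else 1)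
      (Function.update v l (v l + ∏ i ∈ I, v i)) := by
  intro N e
  refine ⟨[⟨I.map e, e l, by simpa using hl, by simpa using hI⟩], fun wC wT _ _ => ?_,
    fun x V hV j => ?_⟩
  · by_cases h : I.card < 2 <;> simp [Circuit.weight, Gate.weight, h]
  · have hprod : ∀ J : Finset L,
        decide (∀ i ∈ J.map e, V i = true) = (∏ i ∈ J, v i) x := by
      intro J
      induction J using Finset.induction_on with
      | empty => simp [Bool.one_eq_true]
      | insert a J ha ih =>
        rw [Finset.prod_insert ha, Pi.mul_apply, ← ih, Bool.mul_eq_and, ← hV a]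
        simp
    simp only [Circuit.run, List.foldl_cons, List.foldl_nil, Gate.apply, hprod I]
    by_cases hj : j = l
    · subst hj
      simp [hV, Bool.add_eq_xor]
    · rw [Function.update_of_ne (e.injective.ne hj), Function.update_of_ne hj, hV]

theorem not [DecidableEq L] (v : L → X → Bool) (l : L) :
    Reach v 1 0 (Function.update v l (v l + 1)) := by
  simpa using gate v ∅ l (by simp) (by simp)

theorem cnot [DecidableEq L] (v : L → X → Bool) {a l : L} (h : l ≠ a) :
    Reach v 1 0 (Function.update v l (v l + v a)) := by
  simpa using gate v {a} l (by simpa using h) (by simp)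

theorem toffoli [DecidableEq L] (v : L → X → Bool) {a b l : L} (hab : a ≠ b) (ha : l ≠ a)
    (hb : l ≠ b) : Reach v 0 1 (Function.update v l (v l + v a * v b)) := by
  simpa [hab] using gate v {a, b} l (by simp [ha, hb]) (by simp [hab])

/-- A straight-line computation on fresh lines: if every line of `F` is initially `0` and its
desired contents is a constant, a product or a sum of the contents of two lines of smaller rank,
then all of `F` can be filled with two CNOT gates and one Toffoli gate per line. -/
theorem fill [DecidableEq L] (r : L → ℕ) (w : L → X → Bool) (F : Finset L)
    (hF : ∀ l ∈ F, w l = 0 ∨ w l = 1 ∨ ∃ a b, r a < r l ∧ r b < r l ∧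
      (a ≠ b ∧ w l = w a * w b ∨ w l = w a + w b)) :
    Reach (fun l => if l ∈ F then 0 else w l) (2 * F.card) F.card w := by
  induction F using Finset.induction_on_max_value r generalizing w with
  | empty => simpa using refl w
  | insert l F hl hmax ih =>
    -- A line of maximal rank is filled last, when all the lines it depends on are ready.
    have key : Reach (Function.update w l 0) 2 1 w := by
      have fin : ∀ y, y = w l → Function.update (Function.update w l 0) l y = w := by
        rintro y rfl; simp
      rcases hF l (Finset.mem_insert_self _ _) with h | h | ⟨a, b, ha, hb, h⟩
      · have := refl (Function.update w l 0)
        rw [← h, Function.update_eq_self] at this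
        rw [← h, Function.update_eq_self]
        exact this.mono (by simp) (by simp)
      · have := Reach.not (Function.update w l 0) l
        rw [fin _ (by simp [h])] at this
        exact this.mono (by simp) (by simp)
      · have hla : a ≠ l := by rintro rfl; exact lt_irrefl _ ha
        have hlb : b ≠ l := by rintro rfl; exact lt_irrefl _ hb
        rcases h with ⟨hab, h⟩ | h
        · have := toffoli (Function.update w l 0) hab hla.symm hlb.symm
          rw [fin _ (by simp [h, hla, hlb])] at this
          exact this.mono (by simp) (by simp)
        · have h1 := cnot (Function.update w l 0) hla.symm
          have h2 := cnot (Function.update (Function.update w l 0) l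
            (Function.update w l 0 l + Function.update w l 0 a)) hlb.symm
          have := h1.trans h2
          rw [Function.update_idem, fin _ (by simp [h, hla, hlb])] at this
          exact this.mono (by simp) (by simp)
    have hstart : Reach (fun j => if j ∈ insert l F then 0 else w j) (2 * F.card) F.card
        (Function.update w l 0) := by
      have hst : (fun j => if j ∈ insert l F then 0 else w j) =
          fun j => if j ∈ F then 0 else Function.update w l 0 j := by
        funext j
        by_cases hj : j = l
        · simp [hj]
        · simp [hj]
      rw [hst]
      -- Lines of `F` have rank at most `r l`, so they do not depend on `l`, and the induction
      -- hypothesis applies with `0` in place of `w l`.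
      refine ih (Function.update w l 0) fun j hj => ?_
      have hjl : j ≠ l := by rintro rfl; exact hl hj
      rw [Function.update_of_ne hjl]
      rcases hF j (Finset.mem_insert_of_mem hj) with h | h | ⟨a, b, ha, hb, h⟩
      · exact .inl h
      · exact .inr (.inl h)
      · refine .inr (.inr ⟨a, b, ha, hb, ?_⟩)
        have hla : a ≠ l := by rintro rfl; exact (hmax j hj).not_gt ha
        have hlb : b ≠ l := by rintro rfl; exact (hmax j hj).not_gt hb
        rwa [Function.update_of_ne hla, Function.update_of_ne hlb]
    have := hstart.trans key
    rw [Finset.card_insert_of_notMem hl]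
    exact this.mono (by omega) (by omega)

theorem add_sum [DecidableEq L] {κ : Type*} (s : Finset κ) (δ : κ → L) (l : L)
    (hδ : ∀ i ∈ s, l ≠ δ i) (v : L → X → Bool) :
    Reach v s.card 0 (Function.update v l (v l + ∑ i ∈ s, v (δ i))) := by
  classical
  induction s using Finset.induction_on with
  | empty => simpa using refl v
  | insert a s ha ih =>
    have h1 := ih fun i hi => hδ i (Finset.mem_insert_of_mem hi)
    have hal := hδ a (Finset.mem_insert_self _ _)
    have h2 := h1.trans (cnot _ hal)
    rw [Function.update_idem, Function.update_self, Function.update_of_ne hal.symm, add_assoc,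
      add_comm _ (v (δ a)), ← Finset.sum_insert (f := fun i => v (δ i)) ha] at h2
    rw [Finset.card_insert_of_notMem ha]
    exact h2

end Reach

/-! ### The accumulation phase -/

/-- The contents of data lines `D`, of one accumulator `none` and of output lines `some i`. -/
def workState {D ι X : Type*} (d : D → X → Bool) (A : X → Bool) (Y : ι → X → Bool) :
    D ⊕ Option ι → X → Bool :=
  Sum.elim d fun o => o.elim A Y

section Accumulate

variable {D ι X : Type*} [DecidableEq D] [DecidableEq ι]

theorem update_workState_none (d : D → X → Bool) (A A' : X → Bool) (Y : ι → X → Bool) :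
    Function.update (workState d A Y) (.inr none) A' = workState d A' Y := by
  funext l
  rcases l with l | _ | l <;> simp [workState]

theorem update_workState_some (d : D → X → Bool) (A : X → Bool) (Y : ι → X → Bool) (i : ι)
    (y : X → Bool) :
    Function.update (workState d A Y) (.inr (some i)) y
      = workState d A (Function.update Y i y) := by
  funext l
  rcases l with l | _ | l
  · simp [workState]
  · simp [workState]
  · by_cases h : l = i
    · subst h; simp [workState]
    · simp [workState, h]

/-- If every function of `H` is a sum of `p` data lines, then products `d (m j) * h j` with
`h j ∈ H` are added to outputs at the price of `p` CNOT gates and one Toffoli gate each. The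
accumulator is never cleared: it passes from one `h j` to the next by adding their difference,
which lies in `H` as well. -/
theorem exists_reach_add_products (d : D → X → Bool) (H : Submodule Bool (X → Bool)) (p : ℕ)
    (hH : ∀ h ∈ H, ∃ δ : Fin p → D, h = ∑ t, d (δ t)) {κ : Type*} (o : κ → ι) (m : κ → D)
    (h : κ → X → Bool) (hh : ∀ j, h j ∈ H) (J : List κ) (A : X → Bool) (hA : A ∈ H)
    (Y : ι → X → Bool) :
    ∃ A', Reach (workState d A Y) (J.length * p) J.length
      (workState d A' fun i => Y i + (J.map fun j => if o j = i then d (m j) * h j else 0).sum) := by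
  induction J generalizing A Y with
  | nil => exact ⟨A, by simpa using Reach.refl _⟩
  | cons j J ih =>
    obtain ⟨δ, hδ⟩ := hH (h j - A) (H.sub_mem (hh j) hA)
    have h1 := Reach.add_sum (Finset.univ : Finset (Fin p)) (fun t => (.inl (δ t) : D ⊕ Option ι))
      (.inr none) (by simp) (workState d A Y)
    have e1 : workState d A Y (.inr none) + ∑ t, workState d A Y (.inl (δ t)) = h j := by
      have : ∑ t, workState d A Y (.inl (δ t)) = h j - A := hδ.symm
      rw [this]
      exact add_sub_cancel A (h j)
    rw [e1, update_workState_none] at h1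
    have h2 := Reach.toffoli (workState d (h j) Y) (a := .inl (m j)) (b := .inr none)
      (l := .inr (some (o j))) (by simp) (by simp) (by simp)
    rw [update_workState_some] at h2
    obtain ⟨A', h3⟩ := ih (h j) (hh j)
      (Function.update Y (o j) (Y (o j) + d (m j) * h j))
    refine ⟨A', ?_⟩
    have h4 := (h1.trans h2).trans h3
    convert h4 using 2
    · rw [Finset.card_fin, List.length_cons]; ring
    · rw [List.length_cons]; ring
    · funext i
      rw [List.map_cons, List.sum_cons, ← add_assoc]
      by_cases hi : o j = i
      · subst hi; simp
      · simp [hi, Function.update_of_ne (Ne.symm hi)]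

end Accumulate

/-! ### Algebraic normal form -/

/-- Every Boolean function is a polynomial over the two-element field. -/
theorem exists_algebraicNormalForm {α : Type*} [Fintype α] [DecidableEq α]
    (f : (α → Bool) → Bool) :
    ∃ c : Finset α → Bool, ∀ y, f y = ∑ T, c T * ∏ i ∈ T, y i := by
  refine ⟨fun T => ∑ a, f a * ∏ i ∈ Finset.univ \ T, (a i + 1), fun y => ?_⟩
  -- The product of all `y i + a i + 1` is the indicator of `y = a`.
  have h1 : f y = ∑ a, f a * ∏ i, (y i + (a i + 1)) := by
    rw [Finset.sum_eq_single y]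
    · have : ∀ b : Bool, b + (b + 1) = 1 := by decide
      simp [this]
    · intro a _ ha
      obtain ⟨i, hi⟩ := Function.ne_iff.mp ha
      have : ∀ b c : Bool, b ≠ c → c + (b + 1) = 0 := by decide
      rw [Finset.prod_eq_zero (Finset.mem_univ i) (this _ _ hi), mul_zero]
    · simp
  have h2 : ∀ a : α → Bool, ∏ i, (y i + (a i + 1)) =
      ∑ T, (∏ i ∈ T, y i) * ∏ i ∈ Finset.univ \ T, (a i + 1) := fun a => by
    rw [Finset.prod_add, Finset.powerset_univ]
  rw [h1]
  simp only [h2, Finset.mul_sum, Finset.sum_mul]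
  rw [Finset.sum_comm]
  refine Finset.sum_congr rfl fun T _ => Finset.sum_congr rfl fun a _ => ?_
  rw [mul_assoc, mul_comm (∏ i ∈ T, y i)]

/-! ### The data lines -/

section Construction

variable {α β : Type*} {n p s : ℕ}

/-- The lines carrying intermediate data: the monomials in the variables of `α`, those in the
variables of `β`, and for each of `p` groups of `s` monomials in the variables of `α` the sums of
all its subsets. -/
abbrev Aux (α β : Type*) (p s : ℕ) : Type _ :=
  Finset α ⊕ Finset β ⊕ (Fin p × Finset (Fin s))

/-- The monomial `∏ x_i`, `i ∈ T`, as a Boolean function of `x`. -/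
def monomial {γ : Type*} (g : γ → Fin n) (T : Finset γ) : BVec n → Bool :=
  fun x => ∏ i ∈ T, x (g i)

/-- The contents of the input lines and of the auxiliary lines after the precomputation. The
variables are split by `ev` into those of `α` and those of `β`, and `σ (t, j)` is the `j`-th
monomial of the group `t`. -/
def data (ev : α ⊕ β ≃ Fin n) (σ : Fin p × Fin s → Finset α) :
    Fin n ⊕ Aux α β p s → BVec n → Bool
  | .inl i => fun x => x i
  | .inr (.inl T) => monomial (fun a => ev (.inl a)) T
  | .inr (.inr (.inl R)) => monomial (fun b => ev (.inr b)) R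
  | .inr (.inr (.inr (t, U))) => ∑ j ∈ U, monomial (fun a => ev (.inl a)) (σ (t, j))

/-- The order in which the data lines are computed. -/
def dataRank [Fintype α] : Fin n ⊕ Aux α β p s → ℕ
  | .inl _ => 0
  | .inr (.inl T) => T.card + 1
  | .inr (.inr (.inl R)) => R.card + 1
  | .inr (.inr (.inr (_, U))) => Fintype.card α + 2 + U.card

theorem monomial_erase {γ : Type*} [DecidableEq γ] (g : γ → Fin n) {T : Finset γ} {i : γ}
    (hi : i ∈ T) : monomial g T = monomial g (T.erase i) * fun x => x (g i) := by
  funext x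
  simp only [monomial, Pi.mul_apply]
  exact (Finset.prod_erase_mul _ _ hi).symm

/-- Every data line is a constant or is obtained by one operation from lines of smaller rank. -/
theorem data_straightLine [Fintype α] [DecidableEq α] [DecidableEq β] (ev : α ⊕ β ≃ Fin n)
    (σ : Fin p × Fin s → Finset α) (l : Aux α β p s) :
    data ev σ (.inr l) = 0 ∨ data ev σ (.inr l) = 1 ∨
      ∃ a b, dataRank a < dataRank (.inr l : Fin n ⊕ Aux α β p s) ∧
        dataRank b < dataRank (.inr l : Fin n ⊕ Aux α β p s) ∧
        (a ≠ b ∧ data ev σ (.inr l) = data ev σ a * data ev σ b ∨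
          data ev σ (.inr l) = data ev σ a + data ev σ b) := by
  rcases l with T | R | ⟨t, U⟩
  · rcases T.eq_empty_or_nonempty with rfl | ⟨i, hi⟩
    · exact .inr (.inl (by funext x; simp [data, monomial]))
    · refine .inr (.inr ⟨.inr (.inl (T.erase i)), .inl (ev (.inl i)), ?_, ?_, .inl ⟨by simp, ?_⟩⟩)
      · have := Finset.card_erase_lt_of_mem hi
        simpa [dataRank] using this
      · simp [dataRank]
      · exact monomial_erase _ hi
  · rcases R.eq_empty_or_nonempty with rfl | ⟨i, hi⟩
    · exact .inr (.inl (by funext x; simp [data, monomial]))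
    · refine .inr (.inr ⟨.inr (.inr (.inl (R.erase i))), .inl (ev (.inr i)), ?_, ?_,
        .inl ⟨by simp, ?_⟩⟩)
      · have := Finset.card_erase_lt_of_mem hi
        simpa [dataRank] using this
      · simp [dataRank]
      · exact monomial_erase _ hi
  · rcases U.eq_empty_or_nonempty with rfl | ⟨j, hj⟩
    · exact .inl (by simp [data])
    · refine .inr (.inr ⟨.inr (.inr (.inr (t, U.erase j))), .inr (.inl (σ (t, j))), ?_, ?_,
        .inr ?_⟩)
      · have := Finset.card_erase_lt_of_mem hj
        simpa [dataRank] using this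
      · have := (σ (t, j)).card_le_univ
        simp only [dataRank]
        omega
      · exact (Finset.sum_erase_add _ _ hj).symm

/-- A linear combination of monomials in the variables of `α` is the sum of one precomputed subset
sum from each group. -/
theorem exists_sum_groups (ev : α ⊕ β ≃ Fin n) (σ : Fin p × Fin s → Finset α)
    (hσ : Function.Surjective σ) (h : BVec n → Bool)
    (hh : h ∈ Submodule.span Bool (Set.range (monomial fun a => ev (.inl a)))) :
    ∃ δ : Fin p → Fin n ⊕ Aux α β p s, h = ∑ t, data ev σ (δ t) := by
  rw [← hσ.range_comp, Submodule.mem_span_range_iff_exists_fun] at hh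
  obtain ⟨c, rfl⟩ := hh
  refine ⟨fun t => .inr (.inr (.inr (t, Finset.univ.filter fun j => c (t, j) = true))), ?_⟩
  rw [Fintype.sum_prod_type]
  refine Finset.sum_congr rfl fun t _ => ?_
  simp only [data, Finset.sum_filter]
  refine Finset.sum_congr rfl fun j _ => ?_
  cases c (t, j)
  · exact zero_smul Bool _
  · exact one_smul Bool _

/-- The coefficients of a Boolean function as a polynomial in the variables of `β` are polynomials
in the variables of `α`. -/
theorem exists_coefficients [Fintype α] [Fintype β] [DecidableEq α] [DecidableEq β]
    (ev : α ⊕ β ≃ Fin n) (f : BVec n → Bool) :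
    ∃ h : Finset β → BVec n → Bool,
      (∀ R, h R ∈ Submodule.span Bool (Set.range (monomial fun a => ev (.inl a)))) ∧
      f = ∑ R, monomial (fun b => ev (.inr b)) R * h R := by
  choose c hc using fun y : α → Bool =>
    exists_algebraicNormalForm fun z : β → Bool => f fun j => Sum.elim y z (ev.symm j)
  refine ⟨fun R x => c (fun a => x (ev (.inl a))) R, fun R => ?_, ?_⟩
  -- A second expansion, of the coefficients `c y R` as functions of `y`.
  · obtain ⟨c', hc'⟩ := exists_algebraicNormalForm fun y => c y R
    rw [Submodule.mem_span_range_iff_exists_fun]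
    refine ⟨c', ?_⟩
    funext x
    simp [hc', monomial]
  · funext x
    have hx : (fun j => Sum.elim (fun a => x (ev (.inl a))) (fun b => x (ev (.inr b)))
        (ev.symm j)) = x := by
      funext j
      obtain ⟨i, rfl⟩ := ev.surjective j
      rcases i with i | i <;> simp
    have := hc (fun a => x (ev (.inl a))) (fun b => x (ev (.inr b)))
    rw [hx] at this
    rw [this, Finset.sum_apply]
    refine Finset.sum_congr rfl fun R _ => mul_comm _ _

/-! ### The circuit -/

/-- The precomputation: the inputs are in place, all other lines start at `0`. -/
theorem reach_data [Fintype α] [Fintype β] [DecidableEq α] [DecidableEq β]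
    (ev : α ⊕ β ≃ Fin n) (σ : Fin p × Fin s → Finset α) :
    Reach (workState (Sum.elim (fun i x => x i) 0) 0 (0 : Fin n → BVec n → Bool))
      (2 * Fintype.card (Aux α β p s)) (Fintype.card (Aux α β p s))
      (workState (data ev σ) 0 (0 : Fin n → BVec n → Bool)) := by
  let F : Finset ((Fin n ⊕ Aux α β p s) ⊕ Option (Fin n)) :=
    Finset.univ.map (Function.Embedding.inr.trans Function.Embedding.inl)
  have : DecidableEq (Fin n ⊕ Aux α β p s) := inferInstance
  have h := Reach.fill (Sum.elim dataRank fun _ => 0)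
    (workState (data ev σ) 0 (0 : Fin n → BVec n → Bool)) F (fun l hl => by
      obtain ⟨a, -, rfl⟩ := Finset.mem_map.mp hl
      rcases data_straightLine ev σ a with h | h | ⟨a, b, ha, hb, h⟩
      · exact .inl h
      · exact .inr (.inl h)
      · refine .inr (.inr ⟨.inl a, .inl b, ha, hb, ?_⟩)
        rcases h with ⟨hab, h⟩ | h
        · exact .inl ⟨by simpa using hab, h⟩
        · exact .inr h)
  rw [Finset.card_map, Finset.card_univ] at h
  convert h using 1
  funext l
  rcases l with (l | l) | l
  · have : (.inl (.inl l) : (Fin n ⊕ Aux α β p s) ⊕ Option (Fin n)) ∉ F := by simp [F]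
    rw [if_neg this]
    rfl
  · have : (.inl (.inr l) : (Fin n ⊕ Aux α β p s) ⊕ Option (Fin n)) ∈ F :=
      Finset.mem_map_of_mem _ (Finset.mem_univ l)
    rw [if_pos this]
    rfl
  · have : (.inr l : (Fin n ⊕ Aux α β p s) ⊕ Option (Fin n)) ∉ F := by simp [F]
    rw [if_neg this]
    rfl

/-- All of `f` is computed on the output lines `some i`, without regard to the final contents of the
other lines. -/
theorem reach_function [Fintype α] [Fintype β] [DecidableEq α] [DecidableEq β]
    (ev : α ⊕ β ≃ Fin n) (hps : 2 ^ Fintype.card α ≤ p * s) (f : BVec n → BVec n) :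
    ∃ w : (Fin n ⊕ Aux α β p s) ⊕ Option (Fin n) → BVec n → Bool,
      (∀ i x, w (.inr (some i)) x = f x i) ∧
      Reach (workState (Sum.elim (fun i x => x i) 0) 0 0)
        (2 * Fintype.card (Aux α β p s) + n * 2 ^ Fintype.card β * p)
        (Fintype.card (Aux α β p s) + n * 2 ^ Fintype.card β) w := by
  obtain ⟨σ, hσ⟩ : ∃ σ : Fin p × Fin s → Finset α, Function.Surjective σ := by
    obtain ⟨e⟩ := Function.Embedding.nonempty_of_card_le (α := Finset α) (β := Fin p × Fin s)
      (by simpa using hps)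
    exact ⟨Function.invFun e, Function.invFun_surjective e.injective⟩
  choose h hh hf using fun i => exists_coefficients ev fun x => f x i
  obtain ⟨A', hA⟩ := exists_reach_add_products (data ev σ) _ p (exists_sum_groups ev σ hσ)
    (fun j : Fin n × Finset β => j.1) (fun j => .inr (.inr (.inl j.2))) (fun j => h j.1 j.2)
    (fun j => hh j.1 j.2) Finset.univ.toList 0 (Submodule.zero_mem _) 0
  have hlen : (Finset.univ : Finset (Fin n × Finset β)).toList.length
      = n * 2 ^ Fintype.card β := by simp
  rw [hlen] at hA
  refine ⟨_, fun i x => ?_, (reach_data ev σ).trans hA⟩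
  have hsum : ((Finset.univ : Finset (Fin n × Finset β)).toList.map fun j =>
      if j.1 = i then data ev σ (.inr (.inr (.inl j.2))) * h j.1 j.2 else 0).sum
      = fun x => f x i := by
    rw [Finset.sum_map_toList, Fintype.sum_prod_type, Finset.sum_eq_single i]
    · simp only [if_true]
      exact (hf i).symm
    · intro b _ hb
      simp [hb]
    · simp
  simp only [workState, Sum.elim_inr, Option.elim_some]
  rw [hsum]
  simp

end Construction

/-- Nonasymptotic upper bound. Splitting the `n` variables into `k + m` and the `2 ^ k` monomials
in the first `k` variables into `p` groups of `s`, every transformation is implemented with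
`n * 2 ^ m * p` CNOT gates and `n * 2 ^ m` Toffoli gates, up to the cost of the precomputation. -/
theorem exists_circuit {k m n p s q : ℕ} (hn : k + m = n) (hps : 2 ^ k ≤ p * s)
    (hq : 2 ^ k + 2 ^ m + p * 2 ^ s + 1 + n ≤ q) (f : BVec n → BVec n) :
    ∃ S : Circuit (n + q), S.Implements f ∧ ∀ wC wT : ℝ, 0 ≤ wC → 0 ≤ wT →
      S.weight wC wT ≤ wC * (2 * (2 ^ k + 2 ^ m + p * 2 ^ s) + n * 2 ^ m * p : ℕ) +
        wT * (2 ^ k + 2 ^ m + p * 2 ^ s + n * 2 ^ m : ℕ) := by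
  let ev : Fin k ⊕ Fin m ≃ Fin n := finSumFinEquiv.trans (finCongr hn)
  obtain ⟨w, hw, hR⟩ := reach_function (p := p) (s := s) ev (by simpa using hps) f
  have hcard : Fintype.card (Aux (Fin k) (Fin m) p s) = 2 ^ k + 2 ^ m + p * 2 ^ s := by
    simp [add_assoc]
  rw [hcard, Fintype.card_fin] at hR
  obtain ⟨g⟩ := Function.Embedding.nonempty_of_card_le
    (α := Aux (Fin k) (Fin m) p s ⊕ Option (Fin n)) (β := Fin q) (by
      rw [Fintype.card_sum, hcard]
      simp only [Fintype.card_option, Fintype.card_fin]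
      omega)
  -- The input lines keep their places, all other lines are placed among the additional inputs.
  let e' : (Fin n ⊕ Aux (Fin k) (Fin m) p s) ⊕ Option (Fin n) → Fin (n + q) :=
    fun l => finSumFinEquiv (Sum.map id g (Equiv.sumAssoc _ _ _ l))
  have he' : Function.Injective e' := finSumFinEquiv.injective.comp
    ((Function.injective_id.sumMap g.injective).comp (Equiv.injective _))
  obtain ⟨S, hS, hr⟩ := hR (n + q) ⟨e', he'⟩
  -- The permutation of the outputs brings the result lines to the first `n` places.
  let c1 : Fin n ≃ Set.range (Fin.castAdd q : Fin n → Fin (n + q)) :=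
    Equiv.ofInjective _ (Fin.castAdd_injective n q)
  let c2 : Fin n ≃ Set.range (fun i : Fin n => e' (.inr (some i))) :=
    Equiv.ofInjective _ fun i j h => by simpa using he' h
  refine ⟨S, ⟨Equiv.extendSubtype (c1.symm.trans c2), fun x i => ?_⟩, hS⟩
  have hπ : Equiv.extendSubtype (c1.symm.trans c2) (Fin.castAdd q i) = e' (.inr (some i)) := by
    rw [Equiv.extendSubtype_apply_of_mem (c1.symm.trans c2) _ (Set.mem_range_self i)]
    have : c1.symm ⟨Fin.castAdd q i, Set.mem_range_self i⟩ = i :=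
      c1.symm_apply_apply i
    rw [Equiv.trans_apply, this]
    rfl
  rw [hπ, ← hw]
  refine hr x _ (fun l => ?_) _
  rcases l with (l | l) | l
  · simp [e', workState]
  · simp [e', workState]; rfl
  · rcases l with _ | l
    · simp [e', workState]; rfl
    · simp [e', workState]; rfl

/-! ### Choice of the parameters and asymptotics -/

theorem quantumWeight_le {wC wT B : ℝ} (hC : 0 ≤ wC) (hT : 0 ≤ wT) {n q : ℕ}
    (h : ∀ f : BVec n → BVec n, ∃ S : Circuit (n + q), S.Implements f ∧ S.weight wC wT ≤ B) :
    quantumWeight wC wT n q ≤ B := by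
  obtain ⟨f, hf, hw⟩ := (isGreatest_quantumWeight wC wT n q).1
  obtain ⟨S, hS, hB⟩ := h f
  rw [← hw]
  exact ((isLeast_minWeight hC hT hf).2 ⟨S, hS, rfl⟩).trans hB

/-- The bound with groups of `n - 2 * k` monomials. This group size is asymptotic to `n` when
`k = o(n)`, and small enough for all subset sums of all groups to be precomputed on `O(2 ^ m)`
lines. -/
theorem quantumWeight_le_of_split {k m n q : ℕ} (hn : k + m = n) (hkm : k < m) (hn12 : 12 ≤ n)
    (hq : n * 2 ^ m ≤ 2 * q) {wC wT : ℝ} (hC : 0 ≤ wC) (hT : 0 ≤ wT) :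
    quantumWeight wC wT n q ≤
      (1 + ((n / (n - 2 * k) - 1) + (n + 8) / 2 ^ k + 4 / n)) *
        (wC * (2 : ℝ) ^ n + wT * (n * (2 : ℝ) ^ m)) := by
  obtain ⟨s, rfl⟩ := Nat.exists_eq_add_of_lt hkm
  set p := 2 ^ k / (s + 1) + 1 with hp
  have hps : 2 ^ k ≤ p * (s + 1) := by
    rw [mul_comm]
    exact (Nat.lt_mul_div_succ _ s.succ_pos).le
  have hP : 2 ^ k + 2 ^ (k + s + 1) + p * 2 ^ (s + 1) ≤ 4 * 2 ^ (k + s + 1) := by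
    have h1 : 2 ^ k ≤ 2 ^ (k + s + 1) := Nat.pow_le_pow_right two_pos (by omega)
    have h2 : 2 ^ (s + 1) ≤ 2 ^ (k + s + 1) := Nat.pow_le_pow_right two_pos (by omega)
    have h3 : 2 ^ k / (s + 1) * 2 ^ (s + 1) ≤ 2 ^ (k + s + 1) := by
      rw [add_assoc, pow_add 2 k]
      exact Nat.mul_le_mul_right _ (Nat.div_le_self _ _)
    rw [hp, add_mul]
    omega
  have hmem : 2 ^ k + 2 ^ (k + s + 1) + p * 2 ^ (s + 1) + 1 + n ≤ q := by
    have h1 : k + s + 1 < 2 ^ (k + s + 1) := Nat.lt_two_pow_self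
    have h2 : 12 * 2 ^ (k + s + 1) ≤ n * 2 ^ (k + s + 1) := Nat.mul_le_mul_right _ hn12
    omega
  refine quantumWeight_le hC hT fun f => ?_
  obtain ⟨S, hS, hw⟩ := exists_circuit hn hps hmem f
  refine ⟨S, hS, (hw wC wT hC hT).trans ?_⟩
  generalize hM : k + s + 1 = m at *
  have hnpos : (0 : ℝ) < n := by exact_mod_cast (by omega : 0 < n)
  have hden : (n : ℝ) - 2 * k = (s + 1 : ℕ) := by
    rw [← hn, ← hM]; push_cast; ring
  have hspos : (0 : ℝ) < (s + 1 : ℕ) := by positivity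
  have hpow : (2 : ℝ) ^ n = 2 ^ k * 2 ^ m := by rw [← hn, pow_add]
  have hratio : 0 ≤ (n : ℝ) / (s + 1 : ℕ) - 1 := by
    rw [sub_nonneg, one_le_div hspos]
    exact_mod_cast (by omega : s + 1 ≤ n)
  have hPr : ((2 ^ k + 2 ^ m + p * 2 ^ (s + 1) : ℕ) : ℝ) ≤ 4 * 2 ^ m := by exact_mod_cast hP
  have hpr : (p : ℝ) ≤ 2 ^ k / (s + 1 : ℕ) + 1 := by
    have := Nat.cast_div_le (α := ℝ) (m := 2 ^ k) (n := s + 1)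
    rw [hp]
    push_cast at this ⊢
    linarith
  have e1 : (0 : ℝ) ≤ (n + 8) / 2 ^ k := by positivity
  have e2 : (0 : ℝ) ≤ 4 / n := by positivity
  rw [hden]
  have hCbound : ((2 * (2 ^ k + 2 ^ m + p * 2 ^ (s + 1)) + n * 2 ^ m * p : ℕ) : ℝ) ≤
      (1 + ((n / (s + 1 : ℕ) - 1) + (n + 8) / 2 ^ k + 4 / n)) * 2 ^ n := by
    calc ((2 * (2 ^ k + 2 ^ m + p * 2 ^ (s + 1)) + n * 2 ^ m * p : ℕ) : ℝ)
        = 2 * ((2 ^ k + 2 ^ m + p * 2 ^ (s + 1) : ℕ) : ℝ) + n * 2 ^ m * p := by push_cast; ring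
      _ ≤ 2 * (4 * 2 ^ m) + n * 2 ^ m * (2 ^ k / (s + 1 : ℕ) + 1) := by gcongr
      _ = (n / (s + 1 : ℕ) + (n + 8) / 2 ^ k) * 2 ^ n := by
        rw [hpow]; field_simp; ring
      _ ≤ _ := mul_le_mul_of_nonneg_right (by linarith) (by positivity)
  have hTbound : ((2 ^ k + 2 ^ m + p * 2 ^ (s + 1) + n * 2 ^ m : ℕ) : ℝ) ≤
      (1 + ((n / (s + 1 : ℕ) - 1) + (n + 8) / 2 ^ k + 4 / n)) * (n * 2 ^ m) := by
    calc ((2 ^ k + 2 ^ m + p * 2 ^ (s + 1) + n * 2 ^ m : ℕ) : ℝ)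
        = ((2 ^ k + 2 ^ m + p * 2 ^ (s + 1) : ℕ) : ℝ) + n * 2 ^ m := by push_cast; ring
      _ ≤ 4 * 2 ^ m + n * 2 ^ m := by gcongr
      _ = (1 + 4 / n) * (n * 2 ^ m) := by field_simp; ring
      _ ≤ _ := mul_le_mul_of_nonneg_right (by linarith) (by positivity)
  have h1 := mul_le_mul_of_nonneg_left hCbound hC
  have h2 := mul_le_mul_of_nonneg_left hTbound hT
  linarith

/-- The error term of `quantumWeight_le_of_split` vanishes for `k = o(n)` and `n = o(2 ^ k)`. -/
theorem tendsto_error {k : ℕ → ℕ} {ψ : ℕ → ℝ} (hψ : Tendsto ψ atTop atTop)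
    (hk : Tendsto (fun n => (k n : ℝ) / n) atTop (𝓝 0))
    (hkψ : ∀ᶠ n : ℕ in atTop, (n : ℝ) * ψ n ≤ 2 ^ k n) :
    Tendsto (fun n : ℕ => ((n / (n - 2 * k n) - 1) + (n + 8) / 2 ^ k n + 4 / n : ℝ))
      atTop (𝓝 0) := by
  have h1 : Tendsto (fun n : ℕ => (n / (n - 2 * k n) - 1 : ℝ)) atTop (𝓝 0) := by
    have : Tendsto (fun n : ℕ => ((1 - 2 * ((k n : ℝ) / n))⁻¹ - 1 : ℝ)) atTop (𝓝 0) := by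
      have := (((hk.const_mul 2).const_sub 1).inv₀ (by norm_num)).sub_const 1
      simpa using this
    refine this.congr' ?_
    filter_upwards [eventually_gt_atTop 0] with n hn
    have hn' : (n : ℝ) ≠ 0 := by positivity
    rw [show (1 - 2 * ((k n : ℝ) / n)) = (n - 2 * k n) / n by field_simp, inv_div]
  have h2 : Tendsto (fun n : ℕ => ((n + 8) / 2 ^ k n : ℝ)) atTop (𝓝 0) := by
    refine squeeze_zero' (.of_forall fun n => by positivity) ?_ (hψ.const_div_atTop 9)
    filter_upwards [hkψ, hψ.eventually_gt_atTop 0, eventually_gt_atTop 0] with n h hp hn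
    have hn' : (1 : ℝ) ≤ n := by exact_mod_cast hn
    rw [div_le_div_iff₀ (by positivity) hp]
    calc ((n : ℝ) + 8) * ψ n ≤ (9 * n) * ψ n := by gcongr; linarith
      _ = 9 * (n * ψ n) := by ring
      _ ≤ _ := by gcongr
  have h3 : Tendsto (fun n : ℕ => (4 / n : ℝ)) atTop (𝓝 0) :=
    tendsto_const_div_atTop_nhds_zero_nat 4
  simpa using (h1.add h2).add h3

end ReversibleCircuit

theorem mainTheorem3
    (φ ψ : ℕ → ℝ) (hφ : Tendsto φ atTop atTop) (hψ : Tendsto ψ atTop atTop)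
    (hφψ : ∀ᶠ n : ℕ in atTop, φ n ≤ (n : ℝ) / (Real.logb 2 (n : ℝ) + Real.logb 2 (ψ n)))
    (q₀ : ℕ → ℕ)
    (hq₀ : (fun n : ℕ => (q₀ n : ℝ)) ~[atTop]
      (fun n : ℕ => (n : ℝ) * (2 : ℝ) ^ ((n : ℤ) - ⌈(n : ℝ) / φ n⌉))) :
    ∃ ε : ℕ → ℝ, Tendsto ε atTop (𝓝 0) ∧
      ∀ᶠ n : ℕ in atTop, ∀ wC wT : ℝ, 0 ≤ wC → 0 ≤ wT →
        ReversibleCircuit.quantumWeight wC wT n (q₀ n) ≤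
          (1 + ε n) * (wC * (2 : ℝ) ^ n +
            wT * ((n : ℝ) * (2 : ℝ) ^ ((n : ℤ) - ⌈(n : ℝ) / φ n⌉))) := by
  set k : ℕ → ℕ := fun n => ⌈(n : ℝ) / φ n⌉₊ with hkdef
  have hφpos := hφ.eventually_gt_atTop 0
  have hk : Tendsto (fun n => (k n : ℝ) / n) atTop (𝓝 0) := by
    have hlim : Tendsto (fun n : ℕ => 1 / φ n + 1 / (n : ℝ)) atTop (𝓝 0) := by
      simpa using (hφ.const_div_atTop 1).add (tendsto_const_div_atTop_nhds_zero_nat (1 : ℝ))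
    refine squeeze_zero' (.of_forall fun n => by positivity) ?_ hlim
    filter_upwards [hφpos, eventually_gt_atTop 0] with n hp hn
    have hn' : (0 : ℝ) < n := by exact_mod_cast hn
    have h1 : (k n : ℝ) < n / φ n + 1 := Nat.ceil_lt_add_one (by positivity)
    calc (k n : ℝ) / n ≤ (n / φ n + 1) / n := by gcongr
      _ = _ := by field_simp
  have hkψ : ∀ᶠ n : ℕ in atTop, (n : ℝ) * ψ n ≤ 2 ^ k n := by
    filter_upwards [hφpos, hφψ, hψ.eventually_gt_atTop 0, eventually_gt_atTop 0]
      with n hp hle hψ' hn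
    have hn' : (0 : ℝ) < n := by exact_mod_cast hn
    have hD : 0 < Real.logb 2 (n : ℝ) + Real.logb 2 (ψ n) := by
      by_contra hD
      exact (hp.trans_le hle).not_ge (div_nonpos_of_nonneg_of_nonpos hn'.le (not_lt.mp hD))
    have h1 : Real.logb 2 (n * ψ n) ≤ k n := by
      rw [Real.logb_mul hn'.ne' hψ'.ne']
      exact ((le_div_comm₀ hp hD).mp hle).trans (Nat.le_ceil _)
    rw [Real.logb_le_iff_le_rpow one_lt_two (by positivity)] at h1
    exact_mod_cast h1
  refine ⟨_, ReversibleCircuit.tendsto_error hψ hk hkψ, ?_⟩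
  -- Half of the additional inputs is more than enough, so a constant factor of `q₀` is immaterial.
  have hq := hq₀.isLittleO.def (c := 1 / 2) (by norm_num)
  filter_upwards [hq, hφpos, hk.eventually_lt_const (show (0 : ℝ) < 1 / 2 by norm_num),
    eventually_ge_atTop 12] with n hqn hp hkn hn wC wT hC hT
  have hn' : (0 : ℝ) < n := by exact_mod_cast (by omega : 0 < n)
  have hlt : 2 * k n < n := by
    rw [div_lt_iff₀ hn'] at hkn
    have : (2 : ℝ) * k n < n := by linarith
    exact_mod_cast this
  have hceil : ⌈(n : ℝ) / φ n⌉ = (k n : ℤ) :=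
    (Int.natCast_ceil_eq_ceil (by positivity)).symm
  have hexp : (2 : ℝ) ^ ((n : ℤ) - ⌈(n : ℝ) / φ n⌉) = 2 ^ (n - k n) := by
    rw [hceil, ← Nat.cast_sub (by omega), zpow_natCast]
  simp only [Pi.sub_apply] at hqn
  rw [hexp] at hqn ⊢
  refine ReversibleCircuit.quantumWeight_le_of_split (by omega) (by omega) hn ?_ hC hT
  rw [Real.norm_of_nonneg (by positivity : (0 : ℝ) ≤ n * 2 ^ (n - k n)), Real.norm_eq_abs] at hqn
  have h2 := (abs_le.mp hqn).1
  have h3 : (n : ℝ) * 2 ^ (n - k n) ≤ 2 * q₀ n := by linarith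
  exact_mod_cast h3
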